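/- **Theorem 2.4.** Let $N\ge 1$ and let $\Omega\subset\mathbb{R}^N$ be a bounded domain (open, connected, non-empty) with boundary of class $C^2$. Let $f\in C^2(\overline\Omega)$ with $f<0$ on $\partial\Omega$, let $u_0\in H^2_0(\Omega)$ with $u_0\ge f$ a.e. in $\Omega$, and let $T>0$. Put $$K=\{v\in H^2_0(\Omega): v\ge f \text{ a.e. in }\Omega\},\qquad E(v)=\frac12\int_\Omega|\Delta v|^2\,dx .$$ For $n\in\mathbb{N}$, $n\ge1$, let $\tau_n=T/n$ and $u_{0,n}=u_0$, and for $i=1,\dots,n$ let inductively $u_{i,n}$ be the solution of the minimum problem $$\min\Big\{E(v)+\frac1{2\tau_n}\int_\Omega(v-u_{i-1,n})^2\,dx \;:\; v\in K\Big\}.$$ Let $V_{i,n}=(u_{i,n}-u_{i-1,n})/\tau_n$. Then, for all $n\ge 1$ and $i=1,\dots,n$, the distribution $$\mu_{i,n}=\Delta^2u_{i,n}+V_{i,n}$$ on $\Omega$ is a nonnegative finite Borel measure on $\Omega$. Moreover there is a constant $C>0$, which may depend on $\Omega$, $f$, $u_0$ and $T$ but not on $n$, such that for every $n\ge 1$ $$\tau_n\sum_{i=1}^n\mu_{i,n}(\Omega)^2<C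 .$$ -/

import Mathlib

open MeasureTheory TopologicalSpace
open scoped Distributions LineDeriv ENNReal

noncomputable section

namespace BiharmonicObstacle

/-- The standard basis vector `e_i` of `ℝ^N`. -/
def stdVec {N : ℕ} (i : Fin N) : EuclideanSpace ℝ (Fin N) := EuclideanSpace.single i (1 : ℝ)

/-- The boundary of the open set `Ω` is of class `C²`: near each boundary point, `Ω` is the
sublevel set `{ψ < 0}` of a `C²` function whose gradient does not vanish at that point. -/
def HasC2Boundary {N : ℕ} (Ω : Opens (EuclideanSpace ℝ (Fin N))) : Prop :=
  ∀ p ∈ frontier (Ω : Set (EuclideanSpace ℝ (Fin N))),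
    ∃ (U : Set (EuclideanSpace ℝ (Fin N))) (ψ : EuclideanSpace ℝ (Fin N) → ℝ),
      IsOpen U ∧ p ∈ U ∧ ContDiffOn ℝ 2 ψ U ∧ fderiv ℝ ψ p ≠ 0 ∧
        (Ω : Set (EuclideanSpace ℝ (Fin N))) ∩ U = {x | x ∈ U ∧ ψ x < 0}

/-- `f ∈ C²(closure Ω)`: `f` is continuous on the closure and twice differentiable in `Ω`, and its
derivatives of order one and two extend continuously to the closure. -/
def MemC2Closure {N : ℕ} (Ω : Opens (EuclideanSpace ℝ (Fin N)))
    (f : EuclideanSpace ℝ (Fin N) → ℝ) : Prop :=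
  ContinuousOn f (closure Ω) ∧
    ∃ (f₁ : EuclideanSpace ℝ (Fin N) → (EuclideanSpace ℝ (Fin N) →L[ℝ] ℝ))
      (f₂ : EuclideanSpace ℝ (Fin N) →
        (EuclideanSpace ℝ (Fin N) →L[ℝ] (EuclideanSpace ℝ (Fin N) →L[ℝ] ℝ))),
      ContinuousOn f₁ (closure Ω) ∧ ContinuousOn f₂ (closure Ω) ∧
        ∀ x ∈ Ω, HasFDerivAt f (f₁ x) x ∧ HasFDerivAt f₁ (f₂ x) x

/-- The distribution `φ ↦ ∫ φ u dx` on `Ω` given by a function `u ∈ L¹_loc(Ω)` (the test functions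
vanish outside `Ω`, so only the values of `u` in `Ω` matter). -/
def toDist {N : ℕ} (Ω : Opens (EuclideanSpace ℝ (Fin N)))
    (u : EuclideanSpace ℝ (Fin N) → ℝ) : 𝓓'(Ω, ℝ) :=
  TestFunction.integralAgainstBilinCLM (ContinuousLinearMap.mul ℝ ℝ) volume u

/-- The Laplacian of a distribution. -/
def distLaplacian {N : ℕ} {Ω : Opens (EuclideanSpace ℝ (Fin N))} (S : 𝓓'(Ω, ℝ)) : 𝓓'(Ω, ℝ) :=
  ∑ i : Fin N, ∂_{stdVec i} (∂_{stdVec i} S)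

/-- `g` is the weak partial derivative `∂_i u` in `Ω` (both functions being in `L¹_loc(Ω)`). -/
def HasWeakPartial {N : ℕ} (Ω : Opens (EuclideanSpace ℝ (Fin N))) (i : Fin N)
    (u g : EuclideanSpace ℝ (Fin N) → ℝ) : Prop :=
  LocallyIntegrableOn u (Ω : Set (EuclideanSpace ℝ (Fin N))) ∧
    LocallyIntegrableOn g (Ω : Set (EuclideanSpace ℝ (Fin N))) ∧
    ∂_{stdVec i} (toDist Ω u) = toDist Ω g

open scoped Classical in
/-- A representative of the weak partial derivative `∂_i u` in `Ω`, unique up to null sets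
(and `0` if `u` has no weak partial derivative). -/
def weakPartial {N : ℕ} (Ω : Opens (EuclideanSpace ℝ (Fin N))) (i : Fin N)
    (u : EuclideanSpace ℝ (Fin N) → ℝ) : EuclideanSpace ℝ (Fin N) → ℝ :=
  if h : ∃ g, HasWeakPartial Ω i u g then h.choose else 0

/-- The weak Laplacian `Δu = ∑ ∂_i ∂_i u`. -/
def weakLaplacian {N : ℕ} (Ω : Opens (EuclideanSpace ℝ (Fin N)))
    (u : EuclideanSpace ℝ (Fin N) → ℝ) : EuclideanSpace ℝ (Fin N) → ℝ :=
  fun x => ∑ i : Fin N, weakPartial Ω i (weakPartial Ω i u) x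

/-- `g ∈ L²(Ω)`. -/
def MemL2 {N : ℕ} (Ω : Opens (EuclideanSpace ℝ (Fin N)))
    (g : EuclideanSpace ℝ (Fin N) → ℝ) : Prop :=
  MemLp g 2 (volume.restrict (Ω : Set (EuclideanSpace ℝ (Fin N))))

/-- `u ∈ H²(Ω)`: `u` and its weak partial derivatives of order one and two are in `L²(Ω)`. -/
def MemH2 {N : ℕ} (Ω : Opens (EuclideanSpace ℝ (Fin N)))
    (u : EuclideanSpace ℝ (Fin N) → ℝ) : Prop :=
  MemL2 Ω u ∧ ∀ i : Fin N, ∃ g, HasWeakPartial Ω i u g ∧ MemL2 Ω g ∧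
    ∀ j : Fin N, ∃ h, HasWeakPartial Ω j g h ∧ MemL2 Ω h

/-- A norm of `H²(Ω)` (meaningful on `H²(Ω)`). -/
def h2Norm {N : ℕ} (Ω : Opens (EuclideanSpace ℝ (Fin N)))
    (u : EuclideanSpace ℝ (Fin N) → ℝ) : ℝ≥0∞ :=
  eLpNorm u 2 (volume.restrict (Ω : Set (EuclideanSpace ℝ (Fin N)))) +
    ∑ i : Fin N, eLpNorm (weakPartial Ω i u) 2
      (volume.restrict (Ω : Set (EuclideanSpace ℝ (Fin N)))) +
    ∑ i : Fin N, ∑ j : Fin N, eLpNorm (weakPartial Ω j (weakPartial Ω i u)) 2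
      (volume.restrict (Ω : Set (EuclideanSpace ℝ (Fin N))))

/-- `u ∈ H²₀(Ω)`: `u` is in the closure of `C_c^∞(Ω)` in `H²(Ω)`. -/
def MemH20 {N : ℕ} (Ω : Opens (EuclideanSpace ℝ (Fin N)))
    (u : EuclideanSpace ℝ (Fin N) → ℝ) : Prop :=
  MemH2 Ω u ∧ ∀ ε : ℝ≥0∞, 0 < ε → ∃ φ : 𝓓(Ω, ℝ), h2Norm Ω (fun x => u x - φ x) < ε

/-- The convex set `K` of all `u ∈ H²₀(Ω)` with `u ≥ f` a.e. in `Ω`. -/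
def obstacleSet {N : ℕ} (Ω : Opens (EuclideanSpace ℝ (Fin N)))
    (f : EuclideanSpace ℝ (Fin N) → ℝ) : Set (EuclideanSpace ℝ (Fin N) → ℝ) :=
  {u | MemH20 Ω u ∧
    ∀ᵐ x ∂(volume.restrict (Ω : Set (EuclideanSpace ℝ (Fin N)))), f x ≤ u x}

/-- The energy `E(u) = (1/2) ∫_Ω |Δu|² dx`. -/
def energy {N : ℕ} (Ω : Opens (EuclideanSpace ℝ (Fin N)))
    (u : EuclideanSpace ℝ (Fin N) → ℝ) : ℝ :=
  1 / 2 * ∫ x in (Ω : Set (EuclideanSpace ℝ (Fin N))), (weakLaplacian Ω u x) ^ 2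

/-- The functional `G(u) = E(u) + (1 / (2τ)) ∫_Ω (u - w)² dx`. -/
def incrementFunctional {N : ℕ} (Ω : Opens (EuclideanSpace ℝ (Fin N))) (τ : ℝ)
    (w u : EuclideanSpace ℝ (Fin N) → ℝ) : ℝ :=
  energy Ω u + 1 / (2 * τ) * ∫ x in (Ω : Set (EuclideanSpace ℝ (Fin N))), (u x - w x) ^ 2

/-- `u 0, …, u n` is the discrete evolution with time step `τ` that starts at `u₀`: for
`i = 1, …, n`, `u i` minimizes `E(v) + (1 / (2τ)) ∫_Ω (v - u (i-1))²` among all `v ∈ K`. -/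
def IsMinimizingScheme {N : ℕ} (Ω : Opens (EuclideanSpace ℝ (Fin N)))
    (f u₀ : EuclideanSpace ℝ (Fin N) → ℝ) (τ : ℝ) (n : ℕ)
    (u : ℕ → EuclideanSpace ℝ (Fin N) → ℝ) : Prop :=
  u 0 = u₀ ∧ ∀ i ∈ Finset.Icc 1 n, u i ∈ obstacleSet Ω f ∧
    ∀ v ∈ obstacleSet Ω f,
      incrementFunctional Ω τ (u (i - 1)) (u i) ≤ incrementFunctional Ω τ (u (i - 1)) v

/-- The discrete velocity `V_i = (u_i - u_{i-1}) / τ` (for `i ≥ 1`). -/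
def discreteVelocity {N : ℕ} (τ : ℝ) (u : ℕ → EuclideanSpace ℝ (Fin N) → ℝ) (i : ℕ) :
    EuclideanSpace ℝ (Fin N) → ℝ :=
  fun x => (u i x - u (i - 1) x) / τ

/-- The distribution `μ_i = Δ²u_i + V_i` on `Ω` (for `i ≥ 1`). -/
def muDist {N : ℕ} (Ω : Opens (EuclideanSpace ℝ (Fin N))) (τ : ℝ)
    (u : ℕ → EuclideanSpace ℝ (Fin N) → ℝ) (i : ℕ) : 𝓓'(Ω, ℝ) :=
  distLaplacian (distLaplacian (toDist Ω (u i))) + toDist Ω (discreteVelocity τ u i)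

/-- The distribution `S` on `Ω` is the (nonnegative Borel) measure `μ`, which is finite and
carried by `Ω`. -/
def IsGivenByFiniteMeasure {N : ℕ} {Ω : Opens (EuclideanSpace ℝ (Fin N))} (S : 𝓓'(Ω, ℝ))
    (μ : Measure (EuclideanSpace ℝ (Fin N))) : Prop :=
  IsFiniteMeasure μ ∧ μ (Ω : Set (EuclideanSpace ℝ (Fin N)))ᶜ = 0 ∧
    ∀ φ : 𝓓(Ω, ℝ), S φ = ∫ x, φ x ∂μ

end BiharmonicObstacle

end

/-!
Write `V` for the discrete velocity and `⟨Δ²u + V, φ⟩ = ∫ Δu Δφ + ∫ V φ`. Minimality of `u = u_i`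
gives the variational inequality `⟨Δ²u + V, v - u⟩ ≥ 0` for the directions `v - u = φ` with a test
function `φ ≥ 0` (`muDist_nonneg`), and for test functions `v ≥ f` (`le_muDist_of_obstacle_le`).
The first makes `Δ²u + V` a nonnegative distribution, hence a positive Radon measure on `Ω` by the
extension theorem of M. Riesz and the Riesz-Markov-Kakutani theorem
(`exists_isGivenByFiniteMeasure`).

The mass up to the boundary is controlled because `f < 0` on `∂Ω`: there are `δ > 0` and a test
function `ψ` with `ψ ≥ f + δ` in `Ω` (`exists_test_above_obstacle`). For a test function `φ` with
`0 ≤ φ ≤ 1`, the function `v = ψ - δ φ` then lies above the obstacle, and the variational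
inequality reads

  `δ ⟨Δ²u + V, φ⟩ ≤ ⟨Δ²u + V, ψ - u⟩ ≤ ‖Δu‖ ‖Δψ‖ + ‖V‖ (‖ψ‖ + ‖u‖)`

in `L²(Ω)` norms (`muDist_le`). Comparing `u_i` with `u_{i-1}` in the minimum problem and
telescoping yields `E(u_k) + (τ / 2) ∑_{i ≤ k} ‖V_i‖² ≤ E(u₀)`, which bounds `‖Δu_i‖`,
`τ ∑ ‖V_i‖²` and, since `u_k = u₀ + τ ∑_{i ≤ k} V_i`, also `‖u_i‖`, uniformly in the number of
steps. Squaring and summing the mass bounds gives the claim.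
-/

namespace BiharmonicObstacle

variable {N : ℕ} {Ω : Opens (EuclideanSpace ℝ (Fin N))}
  {f u₀ u v w g h : EuclideanSpace ℝ (Fin N) → ℝ} {i j : Fin N} {τ : ℝ}

/-! ### Weak derivatives -/

lemma toDist_apply (hu : LocallyIntegrableOn u (Ω : Set (EuclideanSpace ℝ (Fin N))))
    (φ : 𝓓(Ω, ℝ)) : toDist Ω u φ = ∫ x, φ x * u x := by
  exact TestFunction.integralAgainstBilinCLM_eq_integral (B := ContinuousLinearMap.mul ℝ ℝ) hu

lemma setIntegral_testFunction_mul (φ : 𝓓(Ω, ℝ)) (u : EuclideanSpace ℝ (Fin N) → ℝ) :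
    ∫ x in (Ω : Set (EuclideanSpace ℝ (Fin N))), φ x * u x = ∫ x, φ x * u x := by
  refine setIntegral_eq_integral_of_forall_compl_eq_zero fun x hx => ?_
  have : φ x = 0 := image_eq_zero_of_notMem_tsupport fun h => hx (φ.tsupport_subset h)
  simp [this]

lemma locallyIntegrableOn_congr
    (huv : u =ᵐ[volume.restrict (Ω : Set (EuclideanSpace ℝ (Fin N)))] v)
    (hu : LocallyIntegrableOn u (Ω : Set (EuclideanSpace ℝ (Fin N)))) :
    LocallyIntegrableOn v (Ω : Set (EuclideanSpace ℝ (Fin N))) := by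
  rw [locallyIntegrableOn_iff Ω.isOpen.isLocallyClosed] at hu ⊢
  exact fun k hk hkc => (hu k hk hkc).congr_fun_ae (ae_restrict_of_ae_restrict_of_subset hk huv)

lemma toDist_congr (huv : u =ᵐ[volume.restrict (Ω : Set (EuclideanSpace ℝ (Fin N)))] v)
    (hu : LocallyIntegrableOn u (Ω : Set (EuclideanSpace ℝ (Fin N)))) :
    toDist Ω u = toDist Ω v := by
  ext φ
  rw [toDist_apply hu, toDist_apply (locallyIntegrableOn_congr huv hu),
    ← setIntegral_testFunction_mul, ← setIntegral_testFunction_mul]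
  refine integral_congr_ae ?_
  filter_upwards [huv] with x hx
  rw [hx]

/-- A locally integrable function is determined almost everywhere by its distribution. -/
lemma ae_eq_of_toDist_eq (hg : LocallyIntegrableOn g (Ω : Set (EuclideanSpace ℝ (Fin N))))
    (hh : LocallyIntegrableOn h (Ω : Set (EuclideanSpace ℝ (Fin N))))
    (H : toDist Ω g = toDist Ω h) :
    g =ᵐ[volume.restrict (Ω : Set (EuclideanSpace ℝ (Fin N)))] h := by
  have key := IsOpen.ae_eq_zero_of_integral_contDiff_smul_eq_zero (μ := volume) Ω.isOpen
    (hg.sub hh) (fun φ hφ hφc hφΩ => by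
      let ψ : 𝓓(Ω, ℝ) := ⟨φ, by simpa using hφ, hφc, hφΩ⟩
      have h1 := toDist_apply hg ψ
      have h2 := toDist_apply hh ψ
      have i1 := TestFunction.integrable_bilin (ContinuousLinearMap.mul ℝ ℝ) hg ψ
      have i2 := TestFunction.integrable_bilin (ContinuousLinearMap.mul ℝ ℝ) hh ψ
      simp only [ContinuousLinearMap.mul_apply'] at i1 i2
      rw [H, h2] at h1
      have := integral_sub i1 i2
      simp only [Pi.sub_apply, smul_eq_mul, mul_sub]
      exact this.trans (by rw [h1, sub_self]))
  rw [Filter.EventuallyEq, ae_restrict_iff' Ω.isOpen.measurableSet]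
  filter_upwards [key] with x hx hxΩ
  exact sub_eq_zero.1 (hx hxΩ)

lemma MemL2.locallyIntegrableOn (hg : MemL2 Ω g) :
    LocallyIntegrableOn g (Ω : Set (EuclideanSpace ℝ (Fin N))) :=
  locallyIntegrableOn_of_locallyIntegrable_restrict (MemLp.locallyIntegrable hg (by norm_num))

lemma memL2_testFunction (φ : 𝓓(Ω, ℝ)) : MemL2 Ω φ :=
  φ.continuous.memLp_of_hasCompactSupport φ.hasCompactSupport

lemma toDist_mul_add (hg : LocallyIntegrableOn g (Ω : Set (EuclideanSpace ℝ (Fin N))))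
    (hh : LocallyIntegrableOn h (Ω : Set (EuclideanSpace ℝ (Fin N)))) (c : ℝ) :
    toDist Ω (fun x => c * g x + h x) = c • toDist Ω g + toDist Ω h := by
  ext φ
  have i1 := TestFunction.integrable_bilin (ContinuousLinearMap.mul ℝ ℝ) hg φ
  have i2 := TestFunction.integrable_bilin (ContinuousLinearMap.mul ℝ ℝ) hh φ
  simp only [ContinuousLinearMap.mul_apply'] at i1 i2
  change _ = c • (toDist Ω g φ) + toDist Ω h φ
  have hs : LocallyIntegrableOn (fun x => c * g x + h x)
      (Ω : Set (EuclideanSpace ℝ (Fin N))) := (hg.smul c).add hh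
  rw [toDist_apply hs, toDist_apply hg, toDist_apply hh, smul_eq_mul,
    ← integral_const_mul, ← integral_add (i1.const_mul c) i2]
  congr with x
  ring

lemma HasWeakPartial.ae_eq (hg : HasWeakPartial Ω i u g) (hh : HasWeakPartial Ω i u h) :
    g =ᵐ[volume.restrict (Ω : Set (EuclideanSpace ℝ (Fin N)))] h :=
  ae_eq_of_toDist_eq hg.2.1 hh.2.1 (hg.2.2.symm.trans hh.2.2)

lemma HasWeakPartial.congr (hg : HasWeakPartial Ω i u g)
    (huv : u =ᵐ[volume.restrict (Ω : Set (EuclideanSpace ℝ (Fin N)))] v)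
    (hgh : g =ᵐ[volume.restrict (Ω : Set (EuclideanSpace ℝ (Fin N)))] h) :
    HasWeakPartial Ω i v h :=
  ⟨locallyIntegrableOn_congr huv hg.1, locallyIntegrableOn_congr hgh hg.2.1, by
    rw [← toDist_congr huv hg.1, hg.2.2, toDist_congr hgh hg.2.1]⟩

lemma HasWeakPartial.weakPartial (hg : HasWeakPartial Ω i u g) :
    HasWeakPartial Ω i u (weakPartial Ω i u) := by
  have H : ∃ g, HasWeakPartial Ω i u g := ⟨g, hg⟩
  rw [BiharmonicObstacle.weakPartial, dif_pos H]
  exact H.choose_spec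

lemma HasWeakPartial.weakPartial_ae_eq (hg : HasWeakPartial Ω i u g) :
    BiharmonicObstacle.weakPartial Ω i u
      =ᵐ[volume.restrict (Ω : Set (EuclideanSpace ℝ (Fin N)))] g :=
  hg.weakPartial.ae_eq hg

lemma HasWeakPartial.mul_add (hu : HasWeakPartial Ω i u g) (hv : HasWeakPartial Ω i v h) (c : ℝ) :
    HasWeakPartial Ω i (fun x => c * u x + v x) (fun x => c * g x + h x) :=
  ⟨(hu.1.smul c).add hv.1, (hu.2.1.smul c).add hv.2.1, by
    rw [toDist_mul_add hu.1 hv.1, toDist_mul_add hu.2.1 hv.2.1, LineDeriv.lineDerivOp_add,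
      LineDeriv.lineDerivOp_smul, hu.2.2, hv.2.2]⟩

lemma lineDerivOp_testFunction_apply (φ : 𝓓(Ω, ℝ)) (v x : EuclideanSpace ℝ (Fin N)) :
    (∂_{v} φ : 𝓓(Ω, ℝ)) x = fderiv ℝ φ x v := by
  rw [TestFunction.lineDerivOp_eq_lineDerivCLM ℝ, TestFunction.lineDerivCLM_eq_fderivCLM,
    TestFunction.fderivCLM_apply_of_le _ (by simp)]

/-- The classical partial derivative of a test function is its weak one. -/
lemma hasWeakPartial_testFunction (i : Fin N) (φ : 𝓓(Ω, ℝ)) :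
    HasWeakPartial Ω i φ (∂_{stdVec i} φ : 𝓓(Ω, ℝ)) := by
  refine ⟨(memL2_testFunction φ).locallyIntegrableOn, (memL2_testFunction _).locallyIntegrableOn,
    ?_⟩
  ext ψ
  have hint (φ ψ : 𝓓(Ω, ℝ)) : Integrable (fun x => φ x * ψ x) :=
    (φ.continuous.mul ψ.continuous).integrable_of_hasCompactSupport φ.hasCompactSupport.mul_right
  have hd (φ : 𝓓(Ω, ℝ)) : Differentiable ℝ φ := φ.contDiff.differentiable (by simp)
  rw [Distribution.lineDerivOp_apply_apply, map_neg,
    toDist_apply (memL2_testFunction _).locallyIntegrableOn,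
    toDist_apply (memL2_testFunction _).locallyIntegrableOn]
  have h1 := hint (∂_{stdVec i} ψ) φ
  have h2 := hint ψ (∂_{stdVec i} φ)
  simp only [lineDerivOp_testFunction_apply] at h1 h2 ⊢
  rw [integral_mul_fderiv_eq_neg_fderiv_mul_of_integrable h1 h2 (hint ψ φ)
    (fun x _ => hd ψ x) (fun x _ => hd φ x)]

/-! ### Functions in `H²` and in `H²₀` -/

/-- The Laplacian of a test function. -/
noncomputable def testLaplacian (φ : 𝓓(Ω, ℝ)) : 𝓓(Ω, ℝ) :=
  ∑ i : Fin N, ∂_{stdVec i} (∂_{stdVec i} φ)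

lemma testLaplacian_apply (φ : 𝓓(Ω, ℝ)) (x : EuclideanSpace ℝ (Fin N)) :
    testLaplacian φ x = ∑ i : Fin N, (∂_{stdVec i} (∂_{stdVec i} φ) : 𝓓(Ω, ℝ)) x := by
  simp [testLaplacian]

lemma MemH2.hasWeakPartial (hu : MemH2 Ω u) (i : Fin N) :
    HasWeakPartial Ω i u (weakPartial Ω i u) := by
  obtain ⟨g, hg, -⟩ := hu.2 i
  exact hg.weakPartial

lemma MemH2.memL2_weakPartial (hu : MemH2 Ω u) (i : Fin N) : MemL2 Ω (weakPartial Ω i u) := by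
  obtain ⟨g, hg, hg2, -⟩ := hu.2 i
  exact (memLp_congr_ae hg.weakPartial_ae_eq).2 hg2

lemma MemH2.hasWeakPartial₂ (hu : MemH2 Ω u) (i j : Fin N) :
    HasWeakPartial Ω j (weakPartial Ω i u) (weakPartial Ω j (weakPartial Ω i u)) := by
  obtain ⟨g, hg, -, hg'⟩ := hu.2 i
  obtain ⟨h, hh, -⟩ := hg' j
  exact (hh.congr hg.weakPartial_ae_eq.symm (Filter.EventuallyEq.refl _ _)).weakPartial

lemma MemH2.memL2_weakPartial₂ (hu : MemH2 Ω u) (i j : Fin N) :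
    MemL2 Ω (weakPartial Ω j (weakPartial Ω i u)) := by
  obtain ⟨g, hg, -, hg'⟩ := hu.2 i
  obtain ⟨h, hh, hh2⟩ := hg' j
  exact (memLp_congr_ae (hh.congr hg.weakPartial_ae_eq.symm
    (Filter.EventuallyEq.refl _ _)).weakPartial_ae_eq).2 hh2

lemma MemH2.memL2_weakLaplacian (hu : MemH2 Ω u) : MemL2 Ω (weakLaplacian Ω u) :=
  memLp_finsetSum _ fun i _ => hu.memL2_weakPartial₂ i i

lemma MemL2.mul_add (hu : MemL2 Ω u) (hv : MemL2 Ω v) (c : ℝ) :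
    MemL2 Ω (fun x => c * u x + v x) :=
  (MemLp.const_mul hu c).add hv

section MulAddTest

variable (hu : MemH2 Ω u) (c : ℝ) (φ : 𝓓(Ω, ℝ))
include hu

lemma MemH2.hasWeakPartial_mul_add_test (i : Fin N) :
    HasWeakPartial Ω i (fun x => c * u x + φ x)
      (fun x => c * weakPartial Ω i u x + (∂_{stdVec i} φ : 𝓓(Ω, ℝ)) x) :=
  (hu.hasWeakPartial i).mul_add (hasWeakPartial_testFunction i φ) c

lemma MemH2.hasWeakPartial₂_mul_add_test (i j : Fin N) :
    HasWeakPartial Ω j (weakPartial Ω i (fun x => c * u x + φ x))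
      (fun x => c * weakPartial Ω j (weakPartial Ω i u) x
        + (∂_{stdVec j} (∂_{stdVec i} φ) : 𝓓(Ω, ℝ)) x) :=
  ((hu.hasWeakPartial₂ i j).mul_add (hasWeakPartial_testFunction j (∂_{stdVec i} φ)) c).congr
    (hu.hasWeakPartial_mul_add_test c φ i).weakPartial_ae_eq.symm (Filter.EventuallyEq.refl _ _)

lemma MemH2.mul_add_test : MemH2 Ω (fun x => c * u x + φ x) := by
  refine ⟨hu.1.mul_add (memL2_testFunction φ) c, fun i => ⟨_, (hu.hasWeakPartial_mul_add_test c φ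
    i).weakPartial, (memLp_congr_ae (hu.hasWeakPartial_mul_add_test c φ i).weakPartial_ae_eq).2
    ((hu.memL2_weakPartial i).mul_add (memL2_testFunction _) c), fun j => ⟨_,
    hu.hasWeakPartial₂_mul_add_test c φ i j,
    (hu.memL2_weakPartial₂ i j).mul_add (memL2_testFunction _) c⟩⟩⟩

lemma MemH2.weakLaplacian_mul_add_test :
    weakLaplacian Ω (fun x => c * u x + φ x)
      =ᵐ[volume.restrict (Ω : Set (EuclideanSpace ℝ (Fin N)))]
      fun x => c * weakLaplacian Ω u x + testLaplacian φ x := by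
  have H : ∀ᵐ x ∂(volume.restrict (Ω : Set (EuclideanSpace ℝ (Fin N)))), ∀ i : Fin N,
      weakPartial Ω i (weakPartial Ω i (fun x => c * u x + φ x)) x
        = c * weakPartial Ω i (weakPartial Ω i u) x
          + (∂_{stdVec i} (∂_{stdVec i} φ) : 𝓓(Ω, ℝ)) x :=
    ae_all_iff.2 fun i => (hu.hasWeakPartial₂_mul_add_test c φ i i).weakPartial_ae_eq
  filter_upwards [H] with x hx
  simp only [weakLaplacian, hx, Finset.sum_add_distrib, Finset.mul_sum, testLaplacian_apply]

end MulAddTest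

lemma MemH2.h2Norm_const_mul_le (hu : MemH2 Ω u) {c : ℝ} (hc : |c| ≤ 1) :
    h2Norm Ω (fun x => c * u x) ≤ h2Norm Ω u := by
  have aux {g h : EuclideanSpace ℝ (Fin N) → ℝ}
      (hgh : h =ᵐ[volume.restrict (Ω : Set (EuclideanSpace ℝ (Fin N)))] fun x => c * g x) :
      eLpNorm h 2 (volume.restrict (Ω : Set (EuclideanSpace ℝ (Fin N))))
        ≤ eLpNorm g 2 (volume.restrict (Ω : Set (EuclideanSpace ℝ (Fin N)))) := by
    refine eLpNorm_mono_ae ?_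
    filter_upwards [hgh] with x hx
    rw [hx, norm_mul, Real.norm_eq_abs c]
    exact mul_le_of_le_one_left (norm_nonneg _) hc
  have hp (i : Fin N) := (hu.hasWeakPartial_mul_add_test c 0 i).weakPartial_ae_eq
  have hp2 (i j : Fin N) := (hu.hasWeakPartial₂_mul_add_test c 0 i j).weakPartial_ae_eq
  simp only [LineDeriv.lineDerivOp_zero, zero_apply, add_zero] at hp hp2
  unfold h2Norm
  gcongr with i _ i _ j _
  · exact aux (Filter.EventuallyEq.refl _ _)
  · exact aux (hp i)
  · exact aux (hp2 i j)

/-- `H²₀(Ω)` is stable under adding test functions and scaling down. -/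
lemma MemH20.mul_add_test (hu : MemH20 Ω u) {c : ℝ} (hc : |c| ≤ 1) (φ : 𝓓(Ω, ℝ)) :
    MemH20 Ω (fun x => c * u x + φ x) := by
  refine ⟨hu.1.mul_add_test c φ, fun ε hε => ?_⟩
  obtain ⟨ψ, hψ⟩ := hu.2 ε hε
  refine ⟨c • ψ + φ, lt_of_le_of_lt ?_ hψ⟩
  have h1 : (fun x => c * u x + φ x - (c • ψ + φ) x) = fun x => c * (u x - ψ x) := by
    ext x
    simp
    ring
  have h2 : MemH2 Ω (fun x => u x - ψ x) := by
    have := hu.1.mul_add_test 1 (-ψ)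
    simpa [← sub_eq_add_neg] using this
  rw [h1]
  exact h2.h2Norm_const_mul_le hc

/-! ### The bilaplacian of a function in `H²` -/

lemma distLaplacian_apply (S : 𝓓'(Ω, ℝ)) (φ : 𝓓(Ω, ℝ)) :
    distLaplacian S φ = S (testLaplacian φ) := by
  simp [distLaplacian, testLaplacian, map_sum]

lemma MemH2.distLaplacian_toDist (hu : MemH2 Ω u) :
    distLaplacian (toDist Ω u) = toDist Ω (weakLaplacian Ω u) := by
  ext φ
  have h1 : distLaplacian (toDist Ω u)
      = ∑ i, toDist Ω (weakPartial Ω i (weakPartial Ω i u)) := by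
    refine Finset.sum_congr rfl fun i _ => ?_
    rw [(hu.hasWeakPartial i).2.2, (hu.hasWeakPartial₂ i i).2.2]
  have h2 : distLaplacian (toDist Ω u) φ
      = ∑ i, toDist Ω (weakPartial Ω i (weakPartial Ω i u)) φ := by
    rw [h1]
    simp
  have hloc (i : Fin N) := (hu.hasWeakPartial₂ i i).2.1
  rw [h2, toDist_apply hu.memL2_weakLaplacian.locallyIntegrableOn]
  simp only [toDist_apply (hloc _), weakLaplacian, Finset.mul_sum]
  rw [integral_finsetSum]
  intro i _
  exact TestFunction.integrable_bilin (ContinuousLinearMap.mul ℝ ℝ) (hloc i) φ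

/-- Only two of the four derivatives of `Δ²u` have to be moved to the test function. -/
lemma MemH2.bilaplacian_apply (hu : MemH2 Ω u) (φ : 𝓓(Ω, ℝ)) :
    distLaplacian (distLaplacian (toDist Ω u)) φ
      = ∫ x in (Ω : Set (EuclideanSpace ℝ (Fin N))), weakLaplacian Ω u x * testLaplacian φ x := by
  rw [hu.distLaplacian_toDist, distLaplacian_apply,
    toDist_apply hu.memL2_weakLaplacian.locallyIntegrableOn, ← setIntegral_testFunction_mul]
  simp only [mul_comm]

/-! ### The norm of `L²(Ω)` -/

/-- The norm of `L²(Ω)`, as a real number (meaningful on functions satisfying `MemL2 Ω`). -/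
noncomputable def l2Norm (Ω : Opens (EuclideanSpace ℝ (Fin N)))
    (g : EuclideanSpace ℝ (Fin N) → ℝ) : ℝ :=
  √(∫ x in (Ω : Set (EuclideanSpace ℝ (Fin N))), g x ^ 2)

lemma l2Norm_nonneg : 0 ≤ l2Norm Ω g := Real.sqrt_nonneg _

lemma sq_l2Norm : l2Norm Ω g ^ 2 = ∫ x in (Ω : Set (EuclideanSpace ℝ (Fin N))), g x ^ 2 :=
  Real.sq_sqrt (integral_nonneg fun _ => sq_nonneg _)

lemma MemL2.integrableOn_mul (hg : MemL2 Ω g) (hh : MemL2 Ω h) :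
    IntegrableOn (fun x => g x * h x) (Ω : Set (EuclideanSpace ℝ (Fin N))) :=
  MemLp.integrable_mul hg hh

lemma MemL2.integral_add_mul_sq (hg : MemL2 Ω g) (hh : MemL2 Ω h) (t : ℝ) :
    ∫ x in (Ω : Set (EuclideanSpace ℝ (Fin N))), (g x + t * h x) ^ 2
      = l2Norm Ω g ^ 2 + 2 * t * (∫ x in (Ω : Set (EuclideanSpace ℝ (Fin N))), g x * h x)
        + t ^ 2 * l2Norm Ω h ^ 2 := by
  have hgg := hg.integrableOn_mul hg
  have hgh := hg.integrableOn_mul hh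
  have hhh := hh.integrableOn_mul hh
  simp only [sq_l2Norm]
  rw [← integral_const_mul, ← integral_const_mul, ← integral_add _ (hgh.const_mul _),
    ← integral_add]
  · congr with x
    ring
  · exact (hgg.congr (by simp [sq])).add (hgh.const_mul _)
  · exact (hhh.congr (by simp [sq])).const_mul _
  · exact hgg.congr (by simp [sq])

lemma MemL2.abs_integral_mul_le (hg : MemL2 Ω g) (hh : MemL2 Ω h) :
    |∫ x in (Ω : Set (EuclideanSpace ℝ (Fin N))), g x * h x| ≤ l2Norm Ω g * l2Norm Ω h := by
  have key (t : ℝ) : 0 ≤ l2Norm Ω h ^ 2 * (t * t)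
      + 2 * (∫ x in (Ω : Set (EuclideanSpace ℝ (Fin N))), g x * h x) * t + l2Norm Ω g ^ 2 := by
    have := hg.integral_add_mul_sq hh t
    have h0 : 0 ≤ ∫ x in (Ω : Set (EuclideanSpace ℝ (Fin N))), (g x + t * h x) ^ 2 :=
      integral_nonneg fun _ => sq_nonneg _
    nlinarith
  have hd := discrim_le_zero key
  rw [discrim] at hd
  refine abs_le_of_sq_le_sq ?_ (mul_nonneg l2Norm_nonneg l2Norm_nonneg)
  nlinarith

lemma MemL2.l2Norm_add_mul_le (hg : MemL2 Ω g) (hh : MemL2 Ω h) {t : ℝ} (ht : 0 ≤ t) :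
    l2Norm Ω (fun x => g x + t * h x) ≤ l2Norm Ω g + t * l2Norm Ω h := by
  have hB := (abs_le.1 (hg.abs_integral_mul_le hh)).2
  refine Real.sqrt_le_iff.2 ⟨add_nonneg l2Norm_nonneg (mul_nonneg ht l2Norm_nonneg), ?_⟩
  rw [hg.integral_add_mul_sq hh t]
  nlinarith [mul_le_mul_of_nonneg_left hB ht]

lemma energy_eq : energy Ω u = 1 / 2 * l2Norm Ω (weakLaplacian Ω u) ^ 2 := by
  rw [energy, sq_l2Norm]

/-! ### The variational inequality -/

/-- The first variation at a minimizer `u` of `E(v) + (1 / (2τ)) ∫ (v - w)²`, in a direction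
`d = a u + φ` that is admissible from `u`. -/
lemma first_variation_nonneg (hu : MemH2 Ω u) (hw : MemL2 Ω w)
    {a : ℝ} (φ : 𝓓(Ω, ℝ)) (hadm : ∀ t, 0 < t → t ≤ 1 →
      incrementFunctional Ω τ w u
        ≤ incrementFunctional Ω τ w (fun x => (1 + t * a) * u x + (t • φ) x)) :
    0 ≤ (∫ x in (Ω : Set (EuclideanSpace ℝ (Fin N))),
          weakLaplacian Ω u x * (a * weakLaplacian Ω u x + testLaplacian φ x))
        + 1 / τ * ∫ x in (Ω : Set (EuclideanSpace ℝ (Fin N))),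
          (u x - w x) * (a * u x + φ x) := by
  have hΔ := hu.memL2_weakLaplacian
  have hd : MemL2 Ω (fun x => a * u x + φ x) := hu.1.mul_add (memL2_testFunction φ) a
  have hΔd : MemL2 Ω (fun x => a * weakLaplacian Ω u x + testLaplacian φ x) :=
    hΔ.mul_add (memL2_testFunction _) a
  have huw : MemL2 Ω (fun x => u x - w x) := hu.1.sub hw
  set A := ∫ x in (Ω : Set (EuclideanSpace ℝ (Fin N))),
          weakLaplacian Ω u x * (a * weakLaplacian Ω u x + testLaplacian φ x)
  set B := ∫ x in (Ω : Set (EuclideanSpace ℝ (Fin N))), (u x - w x) * (a * u x + φ x)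
  -- the increment along the direction is a quadratic polynomial in `t` without constant term
  obtain ⟨q, hq⟩ : ∃ q : ℝ, ∀ t, 0 < t → t ≤ 1 → 0 ≤ t * (A + 1 / τ * B) + t ^ 2 * q := by
    refine ⟨1 / 2 * l2Norm Ω (fun x => a * weakLaplacian Ω u x + testLaplacian φ x) ^ 2
      + 1 / (2 * τ) * l2Norm Ω (fun x => a * u x + φ x) ^ 2, fun t ht0 ht1 => ?_⟩
    have h0 := hadm t ht0 ht1
    have h1 : energy Ω (fun x => (1 + t * a) * u x + (t • φ) x)
        = 1 / 2 * ∫ x in (Ω : Set (EuclideanSpace ℝ (Fin N))), (weakLaplacian Ω u x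
            + t * (a * weakLaplacian Ω u x + testLaplacian φ x)) ^ 2 := by
      rw [energy]
      congr 1
      refine integral_congr_ae ?_
      filter_upwards [hu.weakLaplacian_mul_add_test (1 + t * a) (t • φ)] with x hx
      have : testLaplacian (t • φ) x = t * testLaplacian φ x := by
        simp [testLaplacian_apply, LineDeriv.lineDerivOp_smul, Finset.mul_sum]
      rw [hx, this]
      ring
    have h2 : ∫ x in (Ω : Set (EuclideanSpace ℝ (Fin N))),
          ((1 + t * a) * u x + (t • φ) x - w x) ^ 2
        = ∫ x in (Ω : Set (EuclideanSpace ℝ (Fin N))),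
          ((u x - w x) + t * (a * u x + φ x)) ^ 2 := by
      congr with x
      simp only [smul_apply, smul_eq_mul]
      ring
    simp only [incrementFunctional] at h0
    rw [h1, h2, hΔ.integral_add_mul_sq hΔd, huw.integral_add_mul_sq hd, energy_eq,
      ← sq_l2Norm] at h0
    have h3 : 1 / (2 * τ) * (2 * t * B) = t * (1 / τ * B) := by
      rw [one_div, one_div, mul_inv]
      ring
    nlinarith
  by_contra! hneg
  set s := A + 1 / τ * B
  have hq1 := hq 1 one_pos le_rfl
  have hq0 : 0 < q := by nlinarith
  -- at `t = -s / (2 q)` the polynomial equals `-s² / (4 q)`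
  have h1 : 0 < -s / (2 * q) := div_pos (by linarith) (by linarith)
  have h2 : -s / (2 * q) ≤ 1 := by rw [div_le_one (by linarith)]; nlinarith
  have h3 := hq _ h1 h2
  have h4 : -s / (2 * q) * s + (-s / (2 * q)) ^ 2 * q = -(s ^ 2 / (4 * q)) := by
    field_simp
    ring
  have h5 : 0 < s ^ 2 / (4 * q) := div_pos (by nlinarith) (by linarith)
  linarith

section Step

variable {u : ℕ → EuclideanSpace ℝ (Fin N) → ℝ} {i : ℕ}

lemma memL2_discreteVelocity (hu : MemL2 Ω (u i)) (hw : MemL2 Ω (u (i - 1))) :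
    MemL2 Ω (discreteVelocity τ u i) := by
  have : discreteVelocity τ u i = fun x => τ⁻¹ * (u i x - u (i - 1) x) := by
    ext x
    rw [discreteVelocity, div_eq_inv_mul]
  rw [this]
  exact MemLp.const_mul (hu.sub hw) _

lemma muDist_apply (hu : MemH2 Ω (u i)) (hw : MemL2 Ω (u (i - 1))) (φ : 𝓓(Ω, ℝ)) :
    muDist Ω τ u i φ
      = (∫ x in (Ω : Set (EuclideanSpace ℝ (Fin N))),
          weakLaplacian Ω (u i) x * testLaplacian φ x)
        + ∫ x in (Ω : Set (EuclideanSpace ℝ (Fin N))), discreteVelocity τ u i x * φ x := by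
  have h1 := toDist_apply (memL2_discreteVelocity (τ := τ) hu.1 hw).locallyIntegrableOn φ
  rw [← setIntegral_testFunction_mul] at h1
  change distLaplacian (distLaplacian (toDist Ω (u i))) φ + toDist Ω _ φ = _
  rw [hu.bilaplacian_apply, h1]
  simp only [mul_comm]

/-- The distribution `Δ²u + V` attached to a minimizer is nonnegative, because moving up from an
element of the obstacle set by a nonnegative test function stays in it. -/
lemma muDist_nonneg (hu : u i ∈ obstacleSet Ω f) (hw : MemL2 Ω (u (i - 1)))
    (hmin : ∀ v ∈ obstacleSet Ω f,
      incrementFunctional Ω τ (u (i - 1)) (u i) ≤ incrementFunctional Ω τ (u (i - 1)) v)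
    {φ : 𝓓(Ω, ℝ)} (hφ : ∀ x, 0 ≤ φ x) : 0 ≤ muDist Ω τ u i φ := by
  have key := first_variation_nonneg (τ := τ) (a := 0) hu.1.1 hw φ fun t ht0 _ =>
    hmin _ ⟨hu.1.mul_add_test (by simp) _, by
      filter_upwards [hu.2] with x hx
      have := mul_nonneg ht0.le (hφ x)
      simp only [mul_zero, add_zero, one_mul, smul_apply, smul_eq_mul]
      linarith⟩
  rw [muDist_apply hu.1.1 hw]
  simp only [zero_mul, zero_add] at key
  rw [← integral_const_mul] at key
  refine key.trans_eq ?_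
  congr 2 with x
  rw [discreteVelocity]
  ring

/-- Testing the variational inequality with a test function `ψ` above the obstacle. -/
lemma le_muDist_of_obstacle_le (hu : u i ∈ obstacleSet Ω f) (hw : MemL2 Ω (u (i - 1)))
    (hmin : ∀ v ∈ obstacleSet Ω f,
      incrementFunctional Ω τ (u (i - 1)) (u i) ≤ incrementFunctional Ω τ (u (i - 1)) v)
    {ψ : 𝓓(Ω, ℝ)} (hψ : ∀ x ∈ Ω, f x ≤ ψ x) :
    l2Norm Ω (weakLaplacian Ω (u i)) ^ 2
      + (∫ x in (Ω : Set (EuclideanSpace ℝ (Fin N))), discreteVelocity τ u i x * u i x)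
      ≤ muDist Ω τ u i ψ := by
  have key := first_variation_nonneg (τ := τ) (a := -1) hu.1.1 hw ψ fun t ht0 ht1 =>
    hmin _ ⟨hu.1.mul_add_test (by rw [abs_le]; constructor <;> linarith) _, by
      filter_upwards [hu.2, ae_restrict_mem Ω.isOpen.measurableSet] with x hx hxΩ
      have h1 := mul_le_mul_of_nonneg_left (hψ x hxΩ) ht0.le
      have h2 := mul_le_mul_of_nonneg_left hx (sub_nonneg.2 ht1)
      simp only [smul_apply, smul_eq_mul]
      linarith⟩
  have hΔ := hu.1.1.memL2_weakLaplacian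
  have hV := memL2_discreteVelocity (τ := τ) hu.1.1.1 hw
  rw [muDist_apply hu.1.1 hw]
  have e1 : ∫ x in (Ω : Set (EuclideanSpace ℝ (Fin N))), weakLaplacian Ω (u i) x
        * (-1 * weakLaplacian Ω (u i) x + testLaplacian ψ x)
      = (∫ x in (Ω : Set (EuclideanSpace ℝ (Fin N))),
          weakLaplacian Ω (u i) x * testLaplacian ψ x)
        - l2Norm Ω (weakLaplacian Ω (u i)) ^ 2 := by
    rw [sq_l2Norm, ← integral_sub (hΔ.integrableOn_mul (memL2_testFunction _))
      ((hΔ.integrableOn_mul hΔ).congr (by simp [sq]))]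
    congr with x
    ring
  have e2 : 1 / τ * ∫ x in (Ω : Set (EuclideanSpace ℝ (Fin N))), (u i x - u (i - 1) x)
        * (-1 * u i x + ψ x)
      = (∫ x in (Ω : Set (EuclideanSpace ℝ (Fin N))), discreteVelocity τ u i x * ψ x)
        - ∫ x in (Ω : Set (EuclideanSpace ℝ (Fin N))), discreteVelocity τ u i x * u i x := by
    rw [← integral_sub (hV.integrableOn_mul (memL2_testFunction _))
      (hV.integrableOn_mul hu.1.1.1), ← integral_const_mul]
    congr with x
    rw [discreteVelocity]
    ring
  rw [e1, e2] at key
  linarith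

/-- The energy estimate of one step: compare the minimizer with the previous function. -/
lemma energy_add_le (hτ : 0 < τ) (hw : u (i - 1) ∈ obstacleSet Ω f)
    (hmin : ∀ v ∈ obstacleSet Ω f,
      incrementFunctional Ω τ (u (i - 1)) (u i) ≤ incrementFunctional Ω τ (u (i - 1)) v) :
    energy Ω (u i) + τ / 2 * l2Norm Ω (discreteVelocity τ u i) ^ 2 ≤ energy Ω (u (i - 1)) := by
  have h0 := hmin _ hw
  simp only [incrementFunctional, sub_self, ne_eq, OfNat.ofNat_ne_zero, not_false_eq_true,
    zero_pow, integral_zero, mul_zero, add_zero] at h0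
  have h1 : τ / 2 * l2Norm Ω (discreteVelocity τ u i) ^ 2 = 1 / (2 * τ)
      * ∫ x in (Ω : Set (EuclideanSpace ℝ (Fin N))), (u i x - u (i - 1) x) ^ 2 := by
    rw [sq_l2Norm, ← integral_const_mul, ← integral_const_mul]
    congr with x
    rw [discreteVelocity]
    field_simp
  rw [h1]
  exact h0

end Step

/-! ### Cutoff functions and a test function strictly above the obstacle -/

lemma exists_cutoff {K : Set (EuclideanSpace ℝ (Fin N))} (hK : IsCompact K)
    (hKΩ : K ⊆ (Ω : Set (EuclideanSpace ℝ (Fin N)))) :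
    ∃ χ : 𝓓(Ω, ℝ), (∀ x, 0 ≤ χ x ∧ χ x ≤ 1) ∧ ∀ x ∈ K, χ x = 1 := by
  obtain ⟨L, hL, hKL, hLΩ⟩ := exists_compact_between hK Ω.isOpen hKΩ
  obtain ⟨χ, hχ, hχr, hχs, hχ1⟩ := exists_contMDiff_support_eq_eq_one_iff
    (modelWithCornersSelf ℝ (EuclideanSpace ℝ (Fin N))) (n := (⊤ : ℕ∞)) isOpen_interior
    hK.isClosed hKL
  have hsub : tsupport χ ⊆ L := by
    rw [tsupport, hχs]
    exact closure_minimal interior_subset hL.isClosed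
  exact ⟨⟨χ, hχ.contDiff, hL.of_isClosed_subset (isClosed_tsupport χ) hsub, hsub.trans hLΩ⟩,
    fun x => hχr ⟨x, rfl⟩, fun x hx => (hχ1 x).1 hx⟩

/-- An obstacle that is negative on the boundary lies strictly, by a positive constant, below some
test function: near the boundary it already lies strictly below `0`. -/
lemma exists_test_above_obstacle
    (hΩ : Bornology.IsBounded (Ω : Set (EuclideanSpace ℝ (Fin N))))
    (hf : ContinuousOn f (closure Ω))
    (hf_bdry : ∀ x ∈ frontier (Ω : Set (EuclideanSpace ℝ (Fin N))), f x < 0) :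
    ∃ δ : ℝ, 0 < δ ∧ ∃ ψ : 𝓓(Ω, ℝ), ∀ x ∈ Ω, f x + δ ≤ ψ x := by
  have hcl : IsCompact (closure (Ω : Set (EuclideanSpace ℝ (Fin N)))) := hΩ.isCompact_closure
  have hfr : IsCompact (frontier (Ω : Set (EuclideanSpace ℝ (Fin N)))) :=
    hcl.of_isClosed_subset isClosed_frontier frontier_subset_closure
  obtain ⟨δ, hδ, hfδ⟩ : ∃ δ : ℝ, 0 < δ ∧
      ∀ x ∈ frontier (Ω : Set (EuclideanSpace ℝ (Fin N))), f x < -δ := by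
    rcases Set.eq_empty_or_nonempty (frontier (Ω : Set (EuclideanSpace ℝ (Fin N)))) with h | h
    · exact ⟨1, one_pos, by simp [h]⟩
    · obtain ⟨y, hy, hmax⟩ := hfr.exists_isMaxOn h (hf.mono frontier_subset_closure)
      have := hf_bdry y hy
      refine ⟨-f y / 2, by linarith, fun x hx => ?_⟩
      have := hmax hx
      simp only [Set.mem_ofPred_eq] at this
      linarith
  set K := closure (Ω : Set (EuclideanSpace ℝ (Fin N))) ∩ f ⁻¹' Set.Ici (-δ)
  have hK : IsCompact K := hcl.of_isClosed_subset
    (hf.preimage_isClosed_of_isClosed isClosed_closure isClosed_Ici) Set.inter_subset_left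
  have hKΩ : K ⊆ (Ω : Set (EuclideanSpace ℝ (Fin N))) := by
    rintro x ⟨hx, hxf⟩
    by_contra hxΩ
    have := hfδ x ⟨hx, fun h => hxΩ (interior_subset h)⟩
    simp only [Set.mem_preimage, Set.mem_Ici] at hxf
    linarith
  obtain ⟨χ, hχ, hχ1⟩ := exists_cutoff hK hKΩ
  obtain ⟨m, hm⟩ := (hK.image_of_continuousOn (hf.mono Set.inter_subset_left)).bddAbove
  refine ⟨δ, hδ, max 0 (m + δ) • χ, fun x hx => ?_⟩
  simp only [smul_apply, smul_eq_mul]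
  by_cases hxK : x ∈ K
  · rw [hχ1 x hxK, mul_one]
    have := hm ⟨x, hxK, rfl⟩
    exact le_trans (by linarith) (le_max_right _ _)
  · have h1 : f x < -δ := by
      by_contra! h
      exact hxK ⟨subset_closure hx, h⟩
    have := mul_nonneg (le_max_left 0 (m + δ)) (hχ x).1
    linarith

/-! ### Nonnegative distributions of bounded mass -/

/-- The restriction of test functions to `Ω`, as compactly supported continuous functions. -/
noncomputable def restrictTest (Ω : Opens (EuclideanSpace ℝ (Fin N))) :
    𝓓(Ω, ℝ) →ₗ[ℝ] CompactlySupportedContinuousMap Ω ℝ where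
  toFun φ := ⟨⟨fun x => φ x, φ.continuous.comp continuous_subtype_val⟩, by
    refine HasCompactSupport.intro (K := Subtype.val ⁻¹' tsupport φ) ?_ fun x hx =>
      image_eq_zero_of_notMem_tsupport (f := φ) hx
    exact Topology.IsInducing.subtypeVal.isCompact_preimage' φ.hasCompactSupport
      (by rw [Subtype.range_coe]; exact φ.tsupport_subset)⟩
  map_add' φ ψ := rfl
  map_smul' c φ := rfl

lemma restrictTest_injective : Function.Injective (restrictTest Ω) := by
  intro φ ψ h
  ext x
  by_cases hx : x ∈ Ω
  · exact DFunLike.congr_fun h ⟨x, hx⟩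
  · rw [image_eq_zero_of_notMem_tsupport fun h => hx (φ.tsupport_subset h),
      image_eq_zero_of_notMem_tsupport fun h => hx (ψ.tsupport_subset h)]

/-- The cone of nonnegative functions in `C_c(Ω)`. -/
def nonnegCone (Ω : Opens (EuclideanSpace ℝ (Fin N))) :
    PointedCone ℝ (CompactlySupportedContinuousMap Ω ℝ) where
  carrier := {g | ∀ x, 0 ≤ g x}
  add_mem' h1 h2 x := add_nonneg (h1 x) (h2 x)
  zero_mem' _ := le_rfl
  smul_mem' c _ h x := mul_nonneg c.2 (h x)

/-- A nonnegative distribution extends to a positive functional on `C_c(Ω)`, by the M. Riesz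
extension theorem. -/
lemma exists_positive_extension (S : 𝓓'(Ω, ℝ)) (hpos : ∀ φ : 𝓓(Ω, ℝ), (∀ x, 0 ≤ φ x) → 0 ≤ S φ) :
    ∃ Λ : CompactlySupportedContinuousMap Ω ℝ →ₚ[ℝ] ℝ, ∀ φ, Λ (restrictTest Ω φ) = S φ := by
  let e := LinearEquiv.ofInjective (restrictTest Ω) restrictTest_injective
  let S' : 𝓓(Ω, ℝ) →ₗ[ℝ] ℝ := ⟨⟨S, map_add S⟩, map_smul S⟩
  let F : CompactlySupportedContinuousMap Ω ℝ →ₗ.[ℝ] ℝ :=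
    ⟨LinearMap.range (restrictTest Ω), S'.comp e.symm.toLinearMap⟩
  have hF (φ : 𝓓(Ω, ℝ)) : F ⟨restrictTest Ω φ, φ, rfl⟩ = S φ := by
    change S (e.symm (e φ)) = S φ
    rw [e.symm_apply_apply]
  obtain ⟨G, hG, hG0⟩ := riesz_extension (nonnegCone Ω) F
    (by
      rintro ⟨_, φ, rfl⟩ hφ
      rw [hF]
      refine hpos φ fun x => ?_
      by_cases hx : x ∈ Ω
      · exact hφ ⟨x, hx⟩
      · rw [image_eq_zero_of_notMem_tsupport fun h => hx (φ.tsupport_subset h)])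
    (by
      intro g
      obtain ⟨χ, hχ, hχ1⟩ := exists_cutoff (Ω := Ω)
        (g.hasCompactSupport.isCompact.image continuous_subtype_val)
        (by rintro _ ⟨x, -, rfl⟩; exact x.2)
      obtain ⟨m, hm⟩ := g.continuous.bounded_above_of_compact_support g.hasCompactSupport
      refine ⟨⟨restrictTest Ω (|m| • χ), _, rfl⟩, fun x => ?_⟩
      change 0 ≤ |m| * χ x + g x
      by_cases hx : x ∈ tsupport g
      · rw [hχ1 _ ⟨x, hx, rfl⟩]
        have h1 : -m ≤ g x := (abs_le.1 (hm x)).1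
        have h2 := le_abs_self m
        linarith
      · rw [image_eq_zero_of_notMem_tsupport hx, add_zero]
        exact mul_nonneg (abs_nonneg _) (hχ _).1)
  exact ⟨PositiveLinearMap.mk₀ G fun g hg => hG0 g hg, fun φ => (hG ⟨_, φ, rfl⟩).trans (hF φ)⟩

/-- A nonnegative distribution whose values on cutoff functions are at most `M` is a finite measure
of mass at most `M`. -/
theorem exists_isGivenByFiniteMeasure (S : 𝓓'(Ω, ℝ))
    (hpos : ∀ φ : 𝓓(Ω, ℝ), (∀ x, 0 ≤ φ x) → 0 ≤ S φ) {M : ℝ}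
    (hM : ∀ φ : 𝓓(Ω, ℝ), (∀ x, 0 ≤ φ x ∧ φ x ≤ 1) → S φ ≤ M) :
    ∃ μ : Measure (EuclideanSpace ℝ (Fin N)), IsGivenByFiniteMeasure S μ ∧
      μ.real (Ω : Set (EuclideanSpace ℝ (Fin N))) ≤ M := by
  obtain ⟨Λ, hΛ⟩ := exists_positive_extension S hpos
  have : LocallyCompactSpace Ω := Ω.isOpen.locallyCompactSpace
  have hM0 : 0 ≤ M := by simpa using hM 0 (by simp)
  have hemb : MeasurableEmbedding (Subtype.val : Ω → EuclideanSpace ℝ (Fin N)) :=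
    MeasurableEmbedding.subtype_coe Ω.isOpen.measurableSet
  have hmass : RealRMK.rieszMeasure Λ Set.univ ≤ ENNReal.ofReal M := by
    rw [isOpen_univ.measure_eq_iSup_isCompact]
    refine iSup₂_le fun K _ => iSup_le fun hK => ?_
    obtain ⟨χ, hχ, hχ1⟩ := exists_cutoff (Ω := Ω) (hK.image continuous_subtype_val)
      (by rintro _ ⟨x, -, rfl⟩; exact x.2)
    refine (RealRMK.rieszMeasure_le_of_eq_one Λ (f := restrictTest Ω χ) (fun x => (hχ x).1) hK
      fun x hx => hχ1 _ ⟨x, hx, rfl⟩).trans ?_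
    rw [hΛ]
    exact ENNReal.ofReal_le_ofReal (hM χ hχ)
  have : IsFiniteMeasure (RealRMK.rieszMeasure Λ) := ⟨hmass.trans_lt ENNReal.ofReal_lt_top⟩
  refine ⟨(RealRMK.rieszMeasure Λ).map Subtype.val, ⟨inferInstance, ?_, fun φ => ?_⟩, ?_⟩
  · rw [hemb.map_apply, Set.preimage_compl, Subtype.coe_preimage_self, Set.compl_univ,
      measure_empty]
  · rw [hemb.integral_map, ← hΛ, ← RealRMK.integral_rieszMeasure]
    rfl
  · refine ENNReal.toReal_le_of_le_ofReal hM0 ?_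
    rw [hemb.map_apply]
    exact (measure_mono (Set.subset_univ _)).trans hmass

/-! ### Estimates along the scheme -/

/-- The mass bound of one step. For a test function `ψ ≥ f + δ` and a cutoff function `φ`, also
`ψ - δ φ` lies above the obstacle, so that the variational inequality bounds `δ ⟨Δ²u + V, φ⟩`. -/
lemma muDist_le {u : ℕ → EuclideanSpace ℝ (Fin N) → ℝ} {i : ℕ} {τ δ : ℝ}
    (hu : u i ∈ obstacleSet Ω f) (hw : MemL2 Ω (u (i - 1)))
    (hmin : ∀ v ∈ obstacleSet Ω f,
      incrementFunctional Ω τ (u (i - 1)) (u i) ≤ incrementFunctional Ω τ (u (i - 1)) v)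
    (hδ : 0 < δ) {ψ : 𝓓(Ω, ℝ)} (hψ : ∀ x ∈ Ω, f x + δ ≤ ψ x)
    {φ : 𝓓(Ω, ℝ)} (hφ : ∀ x, 0 ≤ φ x ∧ φ x ≤ 1) :
    muDist Ω τ u i φ ≤ (l2Norm Ω (weakLaplacian Ω (u i)) * l2Norm Ω (testLaplacian ψ)
      + l2Norm Ω (discreteVelocity τ u i) * (l2Norm Ω ψ + l2Norm Ω (u i))) / δ := by
  have h1 := le_muDist_of_obstacle_le hu hw hmin (ψ := ψ - δ • φ) fun x hx => by
    have := mul_le_mul_of_nonneg_left (hφ x).2 hδ.le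
    have := hψ x hx
    simp only [sub_apply, smul_apply, smul_eq_mul]
    linarith
  have hV := memL2_discreteVelocity (τ := τ) hu.1.1.1 hw
  have h2 := (abs_le.1 (hV.abs_integral_mul_le hu.1.1.1)).1
  have h3 := (abs_le.1 (hV.abs_integral_mul_le (memL2_testFunction ψ))).2
  have h4 := (abs_le.1 (hu.1.1.memL2_weakLaplacian.abs_integral_mul_le
    (memL2_testFunction (testLaplacian ψ)))).2
  rw [map_sub, map_smul, smul_eq_mul, muDist_apply hu.1.1 hw ψ] at h1
  have h5 := sq_nonneg (l2Norm Ω (weakLaplacian Ω (u i)))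
  rw [le_div_iff₀ hδ]
  linarith

section Scheme

variable {τ : ℝ} {n : ℕ} {u : ℕ → EuclideanSpace ℝ (Fin N) → ℝ}
  (hS : IsMinimizingScheme Ω f u₀ τ n u) (hu₀ : u₀ ∈ obstacleSet Ω f) (hτ : 0 < τ)
include hS hu₀

lemma IsMinimizingScheme.mem_obstacleSet {i : ℕ} (hi : i ≤ n) : u i ∈ obstacleSet Ω f := by
  rcases Nat.eq_zero_or_pos i with rfl | h
  · rwa [hS.1]
  · exact (hS.2 i (Finset.mem_Icc.2 ⟨h, hi⟩)).1

include hτ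

lemma IsMinimizingScheme.energy_add_sum_le {k : ℕ} (hk : k ≤ n) :
    energy Ω (u k) + τ / 2 * ∑ i ∈ Finset.Icc 1 k, l2Norm Ω (discreteVelocity τ u i) ^ 2
      ≤ energy Ω u₀ := by
  induction k with
  | zero => simp [hS.1]
  | succ k ih =>
    have h1 := ih (by omega)
    have h2 := energy_add_le (i := k + 1) hτ (hS.mem_obstacleSet hu₀ (by simp; omega))
      (hS.2 (k + 1) (Finset.mem_Icc.2 ⟨by omega, hk⟩)).2
    rw [Nat.add_sub_cancel] at h2
    rw [Finset.sum_Icc_succ_top (by omega), mul_add]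
    linarith

/-- The functions of the scheme are bounded in `L²(Ω)`: the increments `τ V_i` are summed by means
of `‖V_i‖ ≤ 1 + ‖V_i‖² / 2` and the energy estimate. -/
lemma IsMinimizingScheme.l2Norm_le {k : ℕ} (hk : k ≤ n) :
    l2Norm Ω (u k) ≤ l2Norm Ω u₀ + (τ * n + energy Ω u₀) := by
  have key : ∀ k ≤ n, l2Norm Ω (u k) ≤ l2Norm Ω u₀
      + τ * ∑ i ∈ Finset.Icc 1 k, l2Norm Ω (discreteVelocity τ u i) := by
    intro k
    induction k with
    | zero => simp [hS.1]
    | succ k ih =>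
      intro hk
      have h1 := ih (by omega)
      have hk0 := (hS.mem_obstacleSet hu₀ (i := k) (by omega)).1.1.1
      have hk1 := (hS.mem_obstacleSet hu₀ hk).1.1.1
      have h2 := hk0.l2Norm_add_mul_le (memL2_discreteVelocity (τ := τ) (i := k + 1) hk1 hk0) hτ.le
      have h3 : (fun x => u k x + τ * discreteVelocity τ u (k + 1) x) = u (k + 1) := by
        ext x
        simp only [discreteVelocity, Nat.add_sub_cancel]
        field_simp
        ring
      rw [h3] at h2
      rw [Finset.sum_Icc_succ_top (by omega), mul_add]
      linarith
  have h1 := key k hk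
  have h2 := hS.energy_add_sum_le hu₀ hτ hk
  have h3 : 0 ≤ energy Ω (u k) := by rw [energy_eq]; positivity
  have h4 : ∑ i ∈ Finset.Icc 1 k, l2Norm Ω (discreteVelocity τ u i)
      ≤ ∑ i ∈ Finset.Icc 1 k, (1 + 1 / 2 * l2Norm Ω (discreteVelocity τ u i) ^ 2) :=
    Finset.sum_le_sum fun i _ => by nlinarith [sq_nonneg (l2Norm Ω (discreteVelocity τ u i) - 1)]
  rw [Finset.sum_add_distrib, ← Finset.mul_sum] at h4
  simp only [Finset.sum_const, Nat.card_Icc, Nat.add_sub_cancel, nsmul_eq_mul, mul_one] at h4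
  have h5 : (k : ℝ) ≤ n := by exact_mod_cast hk
  nlinarith

end Scheme

end BiharmonicObstacle

/-! ### The uniform bound -/

open BiharmonicObstacle in
theorem theorem2p4 {N : ℕ} (hN : 1 ≤ N) (Ω : TopologicalSpace.Opens (EuclideanSpace ℝ (Fin N)))
    (hΩ_conn : IsConnected (Ω : Set (EuclideanSpace ℝ (Fin N))))
    (hΩ_bdd : Bornology.IsBounded (Ω : Set (EuclideanSpace ℝ (Fin N))))
    (hΩ_C2 : BiharmonicObstacle.HasC2Boundary Ω)
    (f : EuclideanSpace ℝ (Fin N) → ℝ) (hf : BiharmonicObstacle.MemC2Closure Ω f)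
    (hf_bdry : ∀ x ∈ frontier (Ω : Set (EuclideanSpace ℝ (Fin N))), f x < 0)
    (u₀ : EuclideanSpace ℝ (Fin N) → ℝ) (hu₀ : BiharmonicObstacle.MemH20 Ω u₀)
    (hu₀f : ∀ᵐ x ∂(MeasureTheory.volume.restrict (Ω : Set (EuclideanSpace ℝ (Fin N)))),
      f x ≤ u₀ x)
    (T : ℝ) (hT : 0 < T) :
    ∃ C : ℝ, 0 < C ∧ ∀ n : ℕ, 1 ≤ n → ∀ u : ℕ → EuclideanSpace ℝ (Fin N) → ℝ,
      BiharmonicObstacle.IsMinimizingScheme Ω f u₀ (T / n) n u →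
      ∃ μ : ℕ → MeasureTheory.Measure (EuclideanSpace ℝ (Fin N)),
        (∀ i ∈ Finset.Icc 1 n, BiharmonicObstacle.IsGivenByFiniteMeasure
          (BiharmonicObstacle.muDist Ω (T / n) u i) (μ i)) ∧
        T / n * ∑ i ∈ Finset.Icc 1 n,
          ((μ i).real (Ω : Set (EuclideanSpace ℝ (Fin N)))) ^ 2 < C := by
  obtain ⟨δ, hδ, ψ, hψ⟩ := exists_test_above_obstacle hΩ_bdd hf.1 hf_bdry
  have hK₀ : u₀ ∈ obstacleSet Ω f := ⟨hu₀, hu₀f⟩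
  set E₀ := energy Ω u₀
  have hE₀ : 0 ≤ E₀ := by
    change 0 ≤ energy Ω u₀
    rw [energy_eq]
    positivity
  set D := l2Norm Ω (testLaplacian ψ)
  set B := l2Norm Ω ψ + (l2Norm Ω u₀ + (T + E₀))
  have hD : 0 ≤ D := l2Norm_nonneg
  have hB : 0 ≤ B := by
    have h1 : 0 ≤ l2Norm Ω ψ := l2Norm_nonneg
    have h2 : 0 ≤ l2Norm Ω u₀ := l2Norm_nonneg
    positivity
  -- twice the sum of the squares of both terms of the mass bound, plus `1` for strictness
  refine ⟨2 / δ ^ 2 * (2 * E₀ * D ^ 2 * T + B ^ 2 * (2 * E₀)) + 1, by positivity,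
    fun n hn u hS => ?_⟩
  have hn0 : (0 : ℝ) < n := by exact_mod_cast hn
  set τ := T / (n : ℝ)
  have hτ : 0 < τ := div_pos hT hn0
  have hτn : τ * n = T := div_mul_cancel₀ T hn0.ne'
  have hstep : ∀ i ∈ Finset.Icc 1 n, ∃ μ : Measure (EuclideanSpace ℝ (Fin N)),
      IsGivenByFiniteMeasure (muDist Ω τ u i) μ ∧ μ.real Ω ^ 2
        ≤ 2 / δ ^ 2 * (2 * E₀ * D ^ 2 + B ^ 2 * l2Norm Ω (discreteVelocity τ u i) ^ 2) := by
    intro i hi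
    obtain ⟨hi1, hin⟩ := Finset.mem_Icc.1 hi
    have hu := hS.mem_obstacleSet hK₀ hin
    have hw := (hS.mem_obstacleSet hK₀ (i := i - 1) (by omega)).1.1.1
    have hmin := (hS.2 i hi).2
    obtain ⟨μ, hμ, hmass⟩ := exists_isGivenByFiniteMeasure (muDist Ω τ u i)
      (fun φ hφ => muDist_nonneg hu hw hmin hφ) (fun φ hφ => muDist_le hu hw hmin hδ hψ hφ)
    refine ⟨μ, hμ, ?_⟩
    set A := l2Norm Ω (weakLaplacian Ω (u i))
    set V := l2Norm Ω (discreteVelocity τ u i)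
    have hV : 0 ≤ V := l2Norm_nonneg
    have hA : A ^ 2 ≤ 2 * E₀ := by
      have h1 := hS.energy_add_sum_le hK₀ hτ hin
      rw [energy_eq] at h1
      have h2 : 0 ≤ τ / 2 * ∑ i ∈ Finset.Icc 1 i, l2Norm Ω (discreteVelocity τ u i) ^ 2 := by
        positivity
      linarith
    have hU := hS.l2Norm_le hK₀ hτ hin
    rw [hτn] at hU
    have h1 : μ.real Ω ≤ (A * D + V * B) / δ := by
      refine hmass.trans ?_
      gcongr
      exact add_le_add le_rfl hU
    calc μ.real Ω ^ 2 ≤ ((A * D + V * B) / δ) ^ 2 := by gcongr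
      _ = 1 / δ ^ 2 * (A * D + V * B) ^ 2 := by ring
      _ ≤ 1 / δ ^ 2 * (2 * (A ^ 2 * D ^ 2 + B ^ 2 * V ^ 2)) := by
          gcongr
          nlinarith [sq_nonneg (A * D - V * B)]
      _ = 2 / δ ^ 2 * (A ^ 2 * D ^ 2 + B ^ 2 * V ^ 2) := by ring
      _ ≤ 2 / δ ^ 2 * (2 * E₀ * D ^ 2 + B ^ 2 * V ^ 2) := by gcongr
  choose! μ hμ hμ2 using hstep
  refine ⟨μ, hμ, lt_add_of_le_of_pos ?_ one_pos⟩
  have hsum := Finset.sum_le_sum hμ2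
  rw [← Finset.mul_sum, Finset.sum_add_distrib, Finset.sum_const, Nat.card_Icc,
    Nat.add_sub_cancel, nsmul_eq_mul, ← Finset.mul_sum] at hsum
  have hvel : τ * ∑ i ∈ Finset.Icc 1 n, l2Norm Ω (discreteVelocity τ u i) ^ 2 ≤ 2 * E₀ := by
    have h1 := hS.energy_add_sum_le hK₀ hτ le_rfl
    have h2 : 0 ≤ energy Ω (u n) := by rw [energy_eq]; positivity
    linarith
  calc τ * ∑ i ∈ Finset.Icc 1 n, (μ i).real Ω ^ 2
      ≤ τ * (2 / δ ^ 2 * (n * (2 * E₀ * D ^ 2)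
        + B ^ 2 * ∑ i ∈ Finset.Icc 1 n, l2Norm Ω (discreteVelocity τ u i) ^ 2)) := by gcongr
    _ = 2 / δ ^ 2 * (2 * E₀ * D ^ 2 * (τ * n)
        + B ^ 2 * (τ * ∑ i ∈ Finset.Icc 1 n, l2Norm Ω (discreteVelocity τ u i) ^ 2)) := by ring
    _ ≤ 2 / δ ^ 2 * (2 * E₀ * D ^ 2 * T + B ^ 2 * (2 * E₀)) := by rw [hτn]; gcongr
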